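/- For non-empty metric spaces $X,Y$ let $d_{GH}(X,Y)\in[0,\infty]$ be their Gromov--Hausdorff distance, i.e. the infimum of the Hausdorff distances between isometric copies of $X$ and $Y$ in a common metric space. Let $\mathbb{R}_+=(0,\infty)$ be the multiplicative group of positive reals. For $\lambda\in\mathbb{R}_+$ let $\lambda X$ be the space $X$ with all distances multiplied by $\lambda$. Put $$\operatorname{St}X=\{\lambda\in\mathbb{R}_+:\lambda X\text{ is isometric to }X\},\quad \operatorname{St}_0X=\{\lambda\in\mathbb{R}_+:d_{GH}(X,\lambda X)=0\},\quad \operatorname{St}[X]=\{\lambda\in\mathbb{R}_+:d_{GH}(X,\lambda X)<\infty\}.$$ If $\operatorname{St}[X]\neq\{1\}$, the center $Z[X]$ of the cloud of $X$ is the class, considered up to isometry, of all non-empty complete metric spaces $Y$ with $d_{GH}(X,Y)<\infty$ and $\operatorname{St}_0Y=\operatorname{St}[X]$. For $A\subseteq\mathbb{R}_+$ the discrete hedgehog $\widehat A$ is the set $\{0\}\cup A$ with the metric in which two different points $x,y$ are at distance $x+y$. Theorem. One has $\operatorname{St}[\widehat{\mathbb{R}_+}]\neq\{1\}$, so that the center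 $Z[\widehat{\mathbb{R}_+}]$ is defined, and: 1. For every subgroup $H\subseteq\mathbb{R}_+$ of cardinality $\mathfrak{c}=2^{\aleph_0}$, the hedgehog $\widehat H$ belongs to $Z[\widehat{\mathbb{R}_+}]$ and $\operatorname{St}\widehat H=H$. 2. $\bigl|Z[\widehat{\mathbb{R}_+}]\bigr|=2^{\mathfrak{c}}$, i.e. there are exactly $2^{\mathfrak c}$ isometry classes of metric spaces in the center. -/

import Mathlib

universe u v

namespace Cloud

/-- The multiplicative group of positive real numbers. -/
abbrev PosReal : Type := {x : ℝ // 0 < x}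

/-- The Gromov--Hausdorff distance (possibly infinite): the infimum of the Hausdorff distances
between the images of `X` and `Y` under isometric embeddings into a common metric space. Replacing
the common space by the union of the two images shows that the universe `max u v` is no
restriction. -/
noncomputable def ghDist (X : Type u) [MetricSpace X] (Y : Type v) [MetricSpace Y] : ENNReal :=
  ⨅ (Z : Type (max u v)) (_ : MetricSpace Z) (f : X → Z) (_ : Isometry f)
    (g : Y → Z) (_ : Isometry g), Metric.hausdorffEDist (Set.range f) (Set.range g)

/-- The space `r X`: a copy of the set `X`, with all distances multiplied by `r > 0`. -/
@[ext]
structure Scaled (r : PosReal) (X : Type u) : Type u where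
  /-- The point of `X` underlying a point of `r X`. -/
  val : X

noncomputable instance Scaled.instMetricSpace (r : PosReal) (X : Type u) [MetricSpace X] :
    MetricSpace (Scaled r X) where
  dist x y := (r : ℝ) * dist x.val y.val
  dist_self x := by rw [dist_self, mul_zero]
  dist_comm x y := by rw [dist_comm]
  dist_triangle x y z := by
    rw [← mul_add]
    exact mul_le_mul_of_nonneg_left (dist_triangle x.val y.val z.val) r.2.le
  eq_of_dist_eq_zero {x y} h := by
    have h' : (r : ℝ) * dist x.val y.val = 0 := h
    exact Scaled.ext (eq_of_dist_eq_zero ((mul_eq_zero.1 h').resolve_left r.2.ne'))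

/-- `St X`: the multipliers `r` for which `r X` is isometric to `X`. -/
def st (X : Type u) [MetricSpace X] : Set PosReal :=
  {r | Nonempty (Scaled r X ≃ᵢ X)}

/-- `St₀ X`: the multipliers `r` for which `r X` is at zero distance from `X`. -/
def stZero (X : Type u) [MetricSpace X] : Set PosReal :=
  {r | ghDist X (Scaled r X) = 0}

/-- `St [X]`: the multipliers `r` for which `r X` is at finite distance from `X`. -/
def stCloud (X : Type u) [MetricSpace X] : Set PosReal :=
  {r | ghDist X (Scaled r X) < ⊤}

/-- `Y` belongs to the center `Z[X]` of the cloud `[X]` of `X`. -/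
def InCenter (X : Type u) [MetricSpace X] (Y : Type v) [MetricSpace Y] : Prop :=
  Nonempty Y ∧ ghDist X Y < ⊤ ∧ CompleteSpace Y ∧ stZero Y = stCloud X

/-- The metric spaces in the universe `v` that belong to the center `Z[X]`. -/
structure CenterSpace (X : Type u) [MetricSpace X] : Type (max u (v + 1)) where
  carrier : Type v
  [metric : MetricSpace carrier]
  mem : InCenter X carrier

attribute [instance] CenterSpace.metric

/-- Isometry of the spaces in the center. -/
instance centerSetoid (X : Type u) [MetricSpace X] : Setoid (CenterSpace.{u, v} X) where
  r Y Y' := Nonempty (Y.carrier ≃ᵢ Y'.carrier)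
  iseqv :=
    { refl := fun Y => ⟨IsometryEquiv.refl Y.carrier⟩
      symm := fun ⟨e⟩ => ⟨e.symm⟩
      trans := fun ⟨e⟩ ⟨e'⟩ => ⟨e.trans e'⟩ }

/-- The center `Z[X]`, its elements being considered up to isometry. -/
def Center (X : Type u) [MetricSpace X] : Type (max u (v + 1)) :=
  Quotient (centerSetoid.{u, v} X)

/-- The underlying set of the discrete hedgehog over `X`: the set `X` with a point `none` (the
center, of coordinate `0`) added. -/
def Hedgehog (X : Set PosReal) : Type := Option X

/-- The coordinate of a point of the hedgehog. -/
def Hedgehog.coord {X : Set PosReal} : Hedgehog X → ℝ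
  | none => 0
  | some x => ((x : PosReal) : ℝ)

theorem Hedgehog.coord_nonneg {X : Set PosReal} : ∀ p : Hedgehog X, 0 ≤ p.coord
  | none => le_refl (0 : ℝ)
  | some x => (x : PosReal).2.le

theorem Hedgehog.coord_add_pos {X : Set PosReal} :
    ∀ p q : Hedgehog X, p ≠ q → 0 < p.coord + q.coord
  | none, none, h => (h rfl).elim
  | some x, q, _ => add_pos_of_pos_of_nonneg (x : PosReal).2 (Hedgehog.coord_nonneg q)
  | none, some y, _ => add_pos_of_nonneg_of_pos (le_refl (0 : ℝ)) (y : PosReal).2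

open Classical in
/-- The distance between two different points of the hedgehog is the sum of their coordinates. -/
noncomputable instance Hedgehog.instMetricSpace (X : Set PosReal) : MetricSpace (Hedgehog X) where
  dist p q := if p = q then 0 else p.coord + q.coord
  dist_self p := if_pos rfl
  dist_comm p q := by
    simp only [eq_comm (a := p), add_comm p.coord]
  dist_triangle p q r := by
    have hp := p.coord_nonneg
    have hq := q.coord_nonneg
    have hr := r.coord_nonneg
    by_cases h1 : p = q
    · subst h1
      simp
    · by_cases h2 : q = r
      · subst h2
        simp
      · rw [if_neg h1, if_neg h2]
        split_ifs <;> linarith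
  eq_of_dist_eq_zero {p q} h := by
    by_contra hne
    have h' : (if p = q then 0 else p.coord + q.coord) = 0 := h
    rw [if_neg hne] at h'
    exact (Hedgehog.coord_add_pos p q hne).ne' h'

end Cloud

namespace Cloud

open Metric Set

/-! ### Correspondences and the Gromov--Hausdorff distance -/

/-! Call a hedgehog "continuum" if it has at most 𝔠 points and 𝔠 of them have coordinates in each
interval `(a, b]` with `0 ≤ a < b`. Cutting the coordinate axis into cells of length ε and matching
cells bijectively shows that any two such hedgehogs are at distance zero
(`IsContinuumHedgehog.hasCorrespondence`). Multiples of continuum hedgehogs are again of this kind,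
so `stZero` and `stCloud` are everything, and all continuum hedgehogs lie in each other's centers.

A subgroup of cardinality 𝔠 gives a continuum hedgehog, by density and a Lindelöf argument.
Isometries preserve coordinates, which yields its stabilizer.

For the count, doubling the spines over an arbitrary set of positive reals gives 2^𝔠 non-isometric
continuum hedgehogs. Conversely, every space in the center is at distance zero from the hedgehog,
which forces at most 𝔠 points, and there are at most 2^𝔠 metrics on subsets of ℝ. -/

/-- There is a correspondence between `X` and `Y` of distortion at most `2 * ε`. -/
def HasCorrespondence (ε : ℝ) (X : Type u) [MetricSpace X] (Y : Type v) [MetricSpace Y] : Prop :=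
  ∃ S : X → Y → Prop, (∀ x, ∃ y, S x y) ∧ (∀ y, ∃ x, S x y) ∧
    ∀ x y x' y', S x y → S x' y' → |dist x x' - dist y y'| ≤ 2 * ε

theorem HasCorrespondence.symm {ε : ℝ} {X : Type u} [MetricSpace X] {Y : Type v} [MetricSpace Y]
    (h : HasCorrespondence ε X Y) : HasCorrespondence ε Y X := by
  obtain ⟨S, h₁, h₂, h⟩ := h
  refine ⟨fun y x => S x y, h₂, h₁, fun y x y' x' hs hs' => ?_⟩
  rw [abs_sub_comm]
  exact h x y x' y' hs hs'

theorem HasCorrespondence.trans {ε δ : ℝ} {X Y Z : Type*} [MetricSpace X] [MetricSpace Y]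
    [MetricSpace Z] (h : HasCorrespondence ε X Y) (h' : HasCorrespondence δ Y Z) :
    HasCorrespondence (ε + δ) X Z := by
  obtain ⟨S, h₁, h₂, h⟩ := h
  obtain ⟨T, k₁, k₂, k⟩ := h'
  refine ⟨fun x z => ∃ y, S x y ∧ T y z, fun x => ?_, fun z => ?_, ?_⟩
  · obtain ⟨y, hy⟩ := h₁ x
    obtain ⟨z, hz⟩ := k₁ y
    exact ⟨z, y, hy, hz⟩
  · obtain ⟨y, hy⟩ := k₂ z
    obtain ⟨x, hx⟩ := h₂ y
    exact ⟨x, y, hx, hy⟩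
  · rintro x z x' z' ⟨y, hy, hz⟩ ⟨y', hy', hz'⟩
    linarith [abs_sub_le (dist x x') (dist y y') (dist z z'), h _ _ _ _ hy hy', k _ _ _ _ hz hz']

theorem HasCorrespondence.scaled {ε : ℝ} {X : Type u} [MetricSpace X] {Y : Type v} [MetricSpace Y]
    (h : HasCorrespondence ε X Y) (r : PosReal) :
    HasCorrespondence (r * ε) (Scaled r X) (Scaled r Y) := by
  obtain ⟨S, h₁, h₂, h⟩ := h
  refine ⟨fun x y => S x.val y.val, fun x => ?_, fun y => ?_, fun x y x' y' hs hs' => ?_⟩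
  · obtain ⟨y, hy⟩ := h₁ x.val
    exact ⟨⟨y⟩, hy⟩
  · obtain ⟨x, hx⟩ := h₂ y.val
    exact ⟨⟨x⟩, hx⟩
  · change |(r : ℝ) * dist x.val x'.val - r * dist y.val y'.val| ≤ _
    rw [← mul_sub, abs_mul, abs_of_pos r.2]
    nlinarith [h _ _ _ _ hs hs', r.2]

theorem HasCorrespondence.of_ghDist_lt {ε : ℝ} {X : Type u} [MetricSpace X] {Y : Type v}
    [MetricSpace Y] (h : ghDist X Y < ENNReal.ofReal ε) : HasCorrespondence ε X Y := by
  simp only [ghDist, iInf_lt_iff] at h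
  obtain ⟨Z, _, f, hf, g, hg, h⟩ := h
  refine ⟨fun x y => dist (f x) (g y) < ε, fun x => ?_, fun y => ?_, fun x y x' y' hs hs' => ?_⟩
  · obtain ⟨_, ⟨y, rfl⟩, hy⟩ := exists_edist_lt_of_hausdorffEDist_lt (mem_range_self x) h
    exact ⟨y, edist_lt_ofReal.1 hy⟩
  · rw [hausdorffEDist_comm] at h
    obtain ⟨_, ⟨x, rfl⟩, hx⟩ := exists_edist_lt_of_hausdorffEDist_lt (mem_range_self y) h
    rw [edist_comm] at hx
    exact ⟨x, edist_lt_ofReal.1 hx⟩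
  · rw [← hf.dist_eq, ← hg.dist_eq]
    have h₁ := dist_triangle4 (f x) (g y) (g y') (f x')
    have h₂ := dist_triangle4 (g y) (f x) (f x') (g y')
    rw [dist_comm (g y') (f x')] at h₁
    rw [dist_comm (g y) (f x)] at h₂
    rw [abs_le]
    constructor <;> linarith

theorem HasCorrespondence.ghDist_le {ε : ℝ} (hε : 0 < ε) {X : Type u} [MetricSpace X] [Nonempty X]
    {Y : Type v} [MetricSpace Y] (h : HasCorrespondence ε X Y) :
    ghDist X Y ≤ ENNReal.ofReal ε := by
  obtain ⟨S, h₁, h₂, h⟩ := h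
  let P : Type (max u v) := {p : X × Y // S p.1 p.2}
  let Φ : P → X := fun p => p.1.1
  let Ψ : P → Y := fun p => p.1.2
  have : Nonempty P := by
    obtain ⟨y, hy⟩ := h₁ (Classical.arbitrary X)
    exact ⟨⟨(_, y), hy⟩⟩
  have H : ∀ p q, |dist (Φ p) (Φ q) - dist (Ψ p) (Ψ q)| ≤ 2 * ε :=
    fun p q => h _ _ _ _ p.2 q.2
  -- Glue `X` and `Y` by placing corresponding points at distance exactly ε; positivity of ε keeps
  -- the two copies apart.
  let m : MetricSpace (X ⊕ Y) := glueMetricApprox Φ Ψ ε hε H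
  have glued : ∀ p, edist (Sum.inl (Φ p) : X ⊕ Y) (Sum.inr (Ψ p)) = ENNReal.ofReal ε := by
    intro p
    rw [edist_dist]
    exact congrArg _ (glueDist_glued_points Φ Ψ ε p)
  have hf : Isometry (Sum.inl : X → X ⊕ Y) := Isometry.of_dist_eq fun _ _ => rfl
  have hg : Isometry (Sum.inr : Y → X ⊕ Y) := Isometry.of_dist_eq fun _ _ => rfl
  refine iInf_le_of_le (X ⊕ Y) <| iInf_le_of_le m <| iInf_le_of_le _ <| iInf_le_of_le hf <|
    iInf_le_of_le _ <| iInf_le_of_le hg <| hausdorffEDist_le_of_mem_edist ?_ ?_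
  · rintro _ ⟨x, rfl⟩
    obtain ⟨y, hy⟩ := h₁ x
    exact ⟨_, ⟨y, rfl⟩, (glued ⟨(x, y), hy⟩).le⟩
  · rintro _ ⟨y, rfl⟩
    obtain ⟨x, hx⟩ := h₂ y
    refine ⟨_, ⟨x, rfl⟩, ?_⟩
    rw [edist_comm]
    exact (glued ⟨(x, y), hx⟩).le

theorem ghDist_eq_zero_iff {X : Type u} [MetricSpace X] [Nonempty X] {Y : Type v} [MetricSpace Y] :
    ghDist X Y = 0 ↔ ∀ ε > 0, HasCorrespondence ε X Y := by
  refine ⟨fun h ε hε => .of_ghDist_lt (by simpa [h] using hε), fun h => ?_⟩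
  refine le_antisymm (ENNReal.le_of_forall_pos_le_add fun ε hε _ => ?_) zero_le
  rw [zero_add, ← ENNReal.ofReal_coe_nnreal]
  exact (h ε hε).ghDist_le hε

theorem exists_hasCorrespondence {X : Type u} [MetricSpace X] {Y : Type v} [MetricSpace Y]
    (h : ghDist X Y < ⊤) : ∃ ε > 0, HasCorrespondence ε X Y := by
  refine ⟨(ghDist X Y).toReal + 1, by positivity, .of_ghDist_lt ?_⟩
  rw [ENNReal.lt_ofReal_iff_toReal_lt h.ne]
  exact lt_add_one _

instance Scaled.instNonempty (r : PosReal) (X : Type u) [Nonempty X] : Nonempty (Scaled r X) :=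
  ⟨⟨Classical.arbitrary X⟩⟩

/-- If two spaces at finite distance are both at zero distance from all their multiples, then the
distance between them is zero. -/
theorem hasCorrespondence_of_stZero_eq_univ {X : Type u} [MetricSpace X] [Nonempty X] {Y : Type v}
    [MetricSpace Y] [Nonempty Y] (h : ghDist X Y < ⊤) (hX : stZero X = univ)
    (hY : stZero Y = univ) {ε : ℝ} (hε : 0 < ε) : HasCorrespondence ε X Y := by
  obtain ⟨δ, hδ, h⟩ := exists_hasCorrespondence h
  -- This factor shrinks the error δ to ε / 3; the chain `X`, `r X`, `r Y`, `Y` then costs ε / 3 per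
  -- link.
  let r : PosReal := ⟨ε / (3 * δ), by positivity⟩
  have hXr : ghDist X (Scaled r X) = 0 := show r ∈ stZero X by simp [hX]
  have hYr : ghDist Y (Scaled r Y) = 0 := show r ∈ stZero Y by simp [hY]
  have h₁ := ghDist_eq_zero_iff.1 hXr (ε / 3) (by positivity)
  have h₂ := ghDist_eq_zero_iff.1 hYr (ε / 3) (by positivity)
  convert (h₁.trans (h.scaled r)).trans h₂.symm using 1
  simp only [r]
  field_simp
  norm_num

/-! ### Abstract hedgehogs -/

/-- The function `c` makes `Y` a hedgehog: it vanishes at some point, and the distance between two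
different points is the sum of their coordinates. -/
structure IsHedgehog (Y : Type u) [MetricSpace Y] (c : Y → ℝ) : Prop where
  nonneg : ∀ p, 0 ≤ c p
  dist_eq : ∀ p q, p ≠ q → dist p q = c p + c q
  exists_center : ∃ o, c o = 0

namespace IsHedgehog

variable {Y : Type u} [MetricSpace Y] {c : Y → ℝ} {Y' : Type v} [MetricSpace Y'] {c' : Y' → ℝ}

theorem eq_of_coord_eq_zero (h : IsHedgehog Y c) {p q : Y} (hp : c p = 0) (hq : c q = 0) :
    p = q := by
  by_contra hne
  have := h.dist_eq p q hne
  rw [hp, hq, add_zero] at this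
  exact hne (eq_of_dist_eq_zero this)

theorem dist_le (h : IsHedgehog Y c) (p q : Y) : dist p q ≤ c p + c q := by
  by_cases hpq : p = q
  · subst hpq
    rw [dist_self]
    linarith [h.nonneg p]
  · exact (h.dist_eq p q hpq).le

/-- The distance between different points is at least either coordinate. So a Cauchy sequence whose
coordinates do not tend to zero is eventually constant; otherwise it converges to the center. -/
theorem completeSpace (h : IsHedgehog Y c) : CompleteSpace Y := by
  refine Metric.complete_of_cauchySeq_tendsto fun w hw => ?_
  by_cases hc : ∃ ε > 0, ∀ N, ∃ n ≥ N, ε ≤ c (w n)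
  · obtain ⟨ε, hε, hc⟩ := hc
    obtain ⟨N, hN⟩ := Metric.cauchySeq_iff.1 hw ε hε
    obtain ⟨n, hn, hcn⟩ := hc N
    refine ⟨w n, tendsto_const_nhds.congr' ?_⟩
    filter_upwards [Filter.eventually_ge_atTop N] with m hm
    by_contra hne
    have h₁ := hN n hn m hm
    rw [h.dist_eq _ _ hne] at h₁
    linarith [h.nonneg (w m)]
  · push Not at hc
    obtain ⟨o, ho⟩ := h.exists_center
    refine ⟨o, Metric.tendsto_atTop.2 fun ε hε => ?_⟩
    obtain ⟨N, hN⟩ := hc ε hε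
    refine ⟨N, fun n hn => (h.dist_le _ _).trans_lt ?_⟩
    rw [ho, add_zero]
    exact hN n hn

/-- The coordinates of a hedgehog with at least three points are determined by the metric. -/
theorem coord_map [Infinite Y] (h : IsHedgehog Y c) (h' : IsHedgehog Y' c') {f : Y → Y'}
    (hf : Isometry f) (p : Y) : c' (f p) = c p := by
  obtain ⟨q, hq⟩ := Infinite.exists_notMem_finset {p}
  classical
  obtain ⟨r, hr⟩ := Infinite.exists_notMem_finset ({p, q} : Finset Y)
  simp only [Finset.mem_singleton, Finset.mem_insert, not_or] at hq hr
  have key : ∀ x y : Y, x ≠ y → c' (f x) + c' (f y) = c x + c y := fun x y hxy => by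
    rw [← h.dist_eq x y hxy, ← h'.dist_eq _ _ (hf.injective.ne hxy), hf.dist_eq]
  -- For distinct points, 2 c(p) = d(q, p) + d(r, p) - d(r, q).
  linarith [key q p hq, key r p hr.1, key r q hr.2]

theorem isometry_of_coord_eq (h : IsHedgehog Y c) (h' : IsHedgehog Y' c') {f : Y → Y'}
    (hf : f.Injective) (hc : ∀ p, c' (f p) = c p) : Isometry f := by
  refine Isometry.of_dist_eq fun p q => ?_
  by_cases hpq : p = q
  · simp [hpq]
  · rw [h.dist_eq p q hpq, h'.dist_eq _ _ (hf.ne hpq), hc, hc]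

theorem scaled (h : IsHedgehog Y c) (r : PosReal) :
    IsHedgehog (Scaled r Y) fun p => r * c p.val where
  nonneg p := mul_nonneg r.2.le (h.nonneg _)
  dist_eq p q hpq := by
    have : p.val ≠ q.val := fun he => hpq (Scaled.ext he)
    rw [← mul_add, ← h.dist_eq _ _ this]
    rfl
  exists_center := by
    obtain ⟨o, ho⟩ := h.exists_center
    exact ⟨⟨o⟩, by simp [ho]⟩

end IsHedgehog

/-! ### Continuum hedgehogs -/

open Cardinal in
/-- A hedgehog all of whose coordinate intervals contain continuum many points. -/
structure IsContinuumHedgehog (Y : Type u) [MetricSpace Y] (c : Y → ℝ) : Prop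
    extends IsHedgehog Y c where
  mk_le : #Y ≤ 𝔠
  le_mk : ∀ a b, 0 ≤ a → a < b → 𝔠 ≤ #{y // a < c y ∧ c y ≤ b}

namespace IsContinuumHedgehog

open Cardinal

variable {Y : Type u} [MetricSpace Y] {c : Y → ℝ} {Y' : Type v} [MetricSpace Y'] {c' : Y' → ℝ}

theorem infinite (h : IsContinuumHedgehog Y c) : Infinite Y := by
  rw [infinite_iff]
  exact aleph0_le_continuum.trans ((h.le_mk 0 1 le_rfl one_pos).trans (mk_subtype_le _))

theorem scaled (h : IsContinuumHedgehog Y c) (r : PosReal) :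
    IsContinuumHedgehog (Scaled r Y) fun p => r * c p.val where
  toIsHedgehog := h.toIsHedgehog.scaled r
  mk_le := (mk_le_of_injective (f := Scaled.val) fun _ _ => Scaled.ext).trans h.mk_le
  le_mk a b ha hab := by
    have hr := r.2
    refine (h.le_mk (a / r) (b / r) (by positivity) (by gcongr)).trans ?_
    refine mk_le_of_injective (f := fun y => ⟨⟨y.1⟩, ?_, ?_⟩) fun y z hyz => ?_
    · have := (div_lt_iff₀ hr).1 y.2.1
      rwa [mul_comm] at this
    · have := (le_div_iff₀ hr).1 y.2.2
      rwa [mul_comm] at this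
    · simpa [Subtype.ext_iff] using hyz

/-- A bijection respecting cells of length ε moves each coordinate by at most ε, hence distances by
at most 2ε. -/
theorem hasCorrespondence (h : IsContinuumHedgehog Y c) (h' : IsContinuumHedgehog Y' c') {ε : ℝ}
    (hε : 0 < ε) : HasCorrespondence ε Y Y' := by
  let k : Y → ℕ := fun y => ⌈c y / ε⌉₊
  let k' : Y' → ℕ := fun y => ⌈c' y / ε⌉₊
  have cell : ∀ n, Nonempty ({y // k y = n} ≃ {y // k' y = n}) := by
    -- Cell 0 holds only the center; cell `n + 1` is the interval `(nε, (n + 1)ε]` and has 𝔠 points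
    -- in both hedgehogs.
    rintro (_ | n)
    · obtain ⟨o, ho⟩ := h.exists_center
      obtain ⟨o', ho'⟩ := h'.exists_center
      have e : ∀ y, k y = 0 ↔ y = o := fun y => by
        rw [Nat.ceil_eq_zero, div_le_iff₀ hε, zero_mul]
        exact ⟨fun hy => h.eq_of_coord_eq_zero (hy.antisymm (h.nonneg y)) ho,
          by rintro rfl; exact ho.le⟩
      have e' : ∀ y, k' y = 0 ↔ y = o' := fun y => by
        rw [Nat.ceil_eq_zero, div_le_iff₀ hε, zero_mul]
        exact ⟨fun hy => h'.eq_of_coord_eq_zero (hy.antisymm (h'.nonneg y)) ho',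
          by rintro rfl; exact ho'.le⟩
      simp only [e, e']
      exact ⟨Equiv.ofUnique _ _⟩
    · have e : ∀ x : ℝ, ⌈x / ε⌉₊ = n + 1 ↔ n * ε < x ∧ x ≤ (n + 1) * ε := fun x => by
        rw [Nat.ceil_eq_iff n.succ_ne_zero, lt_div_iff₀ hε, div_le_iff₀ hε]
        push_cast
        simp
      have h₁ : #{y // k y = n + 1} = 𝔠 := by
        refine ((mk_subtype_le _).trans h.mk_le).antisymm ?_
        simp only [k, e]
        exact h.le_mk _ _ (by positivity) (by linarith)
      have h₂ : #{y // k' y = n + 1} = 𝔠 := by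
        refine ((mk_subtype_le _).trans h'.mk_le).antisymm ?_
        simp only [k', e]
        exact h'.le_mk _ _ (by positivity) (by linarith)
      rw [← lift_mk_eq', h₁, h₂, lift_continuum, lift_continuum]
  let F := fun n => (cell n).some
  let e : Y ≃ Y' := (Equiv.sigmaFiberEquiv k).symm.trans
    ((Equiv.sigmaCongrRight F).trans (Equiv.sigmaFiberEquiv k'))
  have he : ∀ y, k' (e y) = k y := fun y => (F (k y) ⟨y, rfl⟩).2
  have hc : ∀ y, |c y - c' (e y)| ≤ ε := by
    intro y
    have bound : ∀ x : ℝ, 0 ≤ x → x ≤ ⌈x / ε⌉₊ * ε ∧ (⌈x / ε⌉₊ : ℝ) * ε ≤ x + ε := fun x hx => by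
      refine ⟨(div_le_iff₀ hε).1 (Nat.le_ceil _), ?_⟩
      have := mul_le_mul_of_nonneg_right (Nat.ceil_lt_add_one (div_nonneg hx hε.le)).le hε.le
      rwa [add_mul, one_mul, div_mul_cancel₀ _ hε.ne'] at this
    have b₁ := bound _ (h.nonneg y)
    have b₂ := bound _ (h'.nonneg (e y))
    rw [show ⌈c' (e y) / ε⌉₊ = ⌈c y / ε⌉₊ from he y] at b₂
    rw [abs_le]
    constructor <;> linarith [b₁.1, b₁.2, b₂.1, b₂.2]
  refine ⟨fun y y' => e y = y', fun y => ⟨_, rfl⟩, fun y => ⟨_, e.apply_symm_apply y⟩, ?_⟩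
  rintro x _ y _ rfl rfl
  by_cases hxy : x = y
  · simp [hxy, hε.le]
  · rw [h.dist_eq x y hxy, h'.dist_eq _ _ (e.injective.ne hxy)]
    have h₁ := abs_le.1 (hc x)
    have h₂ := abs_le.1 (hc y)
    rw [abs_le]
    constructor <;> linarith

theorem ghDist_eq_zero (h : IsContinuumHedgehog Y c) (h' : IsContinuumHedgehog Y' c') :
    ghDist Y Y' = 0 := by
  have := h.infinite
  exact ghDist_eq_zero_iff.2 fun _ => h.hasCorrespondence h'

theorem stZero_eq_univ (h : IsContinuumHedgehog Y c) : stZero Y = Set.univ :=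
  eq_univ_of_forall fun r => h.ghDist_eq_zero (h.scaled r)

theorem stCloud_eq_univ (h : IsContinuumHedgehog Y c) : stCloud Y = Set.univ :=
  eq_univ_of_forall fun r => (h.ghDist_eq_zero (h.scaled r)).trans_lt ENNReal.zero_lt_top

theorem inCenter (h : IsContinuumHedgehog Y c) (h' : IsContinuumHedgehog Y' c') :
    InCenter Y Y' :=
  ⟨have := h'.infinite; inferInstance, (h.ghDist_eq_zero h').trans_lt ENNReal.zero_lt_top,
    h'.completeSpace, h'.stZero_eq_univ.trans h.stCloud_eq_univ.symm⟩

/-- A space in the center of the cloud of a continuum hedgehog has at most continuum many points. -/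
theorem mk_le_of_inCenter (h : IsContinuumHedgehog Y c) (hY' : InCenter Y Y') : #Y' ≤ 𝔠 := by
  obtain ⟨hne, hfin, -, hst⟩ := hY'
  have := h.infinite
  have close : ∀ n : ℕ, HasCorrespondence (1 / (n + 1)) Y Y' := fun n =>
    hasCorrespondence_of_stZero_eq_univ hfin h.stZero_eq_univ (hst.trans h.stCloud_eq_univ)
      (by positivity)
  choose S h₁ h₂ hS using close
  choose f hf using h₂
  -- A point is determined by its sequence of partners in `Y`, since a common n-th partner bounds
  -- the distance by 2 / (n + 1). Hence at most 𝔠 ^ ℵ₀ = 𝔠 points.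
  have inj : Function.Injective fun (y : Y') (n : ℕ) => f n y := by
    intro y y' hyy'
    refine eq_of_dist_eq_zero (le_antisymm (le_of_forall_pos_le_add fun ε hε => ?_) dist_nonneg)
    obtain ⟨n, hn⟩ := exists_nat_one_div_lt (half_pos hε)
    have := hS n _ _ _ _ (hf n y) (hf n y')
    rw [show f n y = f n y' from congrFun hyy' n, dist_self] at this
    linarith [(abs_le.1 this).1]
  have := lift_mk_le_lift_mk_of_injective inj
  rw [mk_pi, prod_const, mk_nat, lift_aleph0, lift_uzero] at this
  refine (lift_le_continuum (c := #Y')).1 (this.trans ?_)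
  rw [lift_power, lift_aleph0]
  exact (power_le_power_right (lift_le_continuum.2 h.mk_le)).trans continuum_power_aleph0.le

end IsContinuumHedgehog

/-! ### Hedgehogs over subgroups -/

instance PosReal.instMulArchimedean : MulArchimedean PosReal where
  arch x y hy := by
    obtain ⟨n, hn⟩ := pow_unbounded_of_one_lt (x : ℝ) (show (1 : ℝ) < y from hy)
    exact ⟨n, Subtype.coe_le_coe.1 (by simpa using hn.le)⟩

instance PosReal.instOrderTopology : OrderTopology PosReal :=
  inferInstanceAs (OrderTopology (Ioi (0 : ℝ)))

instance PosReal.instDenselyOrdered : DenselyOrdered PosReal :=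
  inferInstanceAs (DenselyOrdered (Ioi (0 : ℝ)))

theorem Hedgehog.dist_of_ne {A : Set PosReal} {p q : Hedgehog A} (h : p ≠ q) :
    dist p q = p.coord + q.coord :=
  if_neg h

theorem Hedgehog.isHedgehog (A : Set PosReal) : IsHedgehog (Hedgehog A) Hedgehog.coord where
  nonneg := Hedgehog.coord_nonneg
  dist_eq _ _ := Hedgehog.dist_of_ne
  exists_center := ⟨none, rfl⟩

open Cardinal in
/-- A subgroup with continuum many elements has continuum many elements in every interval. -/
theorem continuum_le_mk_subgroup_inter_Ioo {H : Subgroup PosReal} (hH : #H = 𝔠) {a b : PosReal}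
    (hab : a < b) : 𝔠 ≤ #{x : H // a < x ∧ (x : PosReal) < b} := by
  have dense : Dense (H : Set PosReal) := by
    refine H.dense_or_cyclic.resolve_right ?_
    rintro ⟨g, hg⟩
    rw [← Subgroup.zpowers_eq_closure] at hg
    have : Countable H := by
      rw [hg]
      exact (countable_range fun n : ℤ => g ^ n).to_subtype
    exact (hH ▸ mk_le_aleph0 (α := H)).not_gt aleph0_lt_continuum
  obtain ⟨g, ⟨hag, hgb⟩, hg⟩ := dense.inter_open_nonempty (Ioo a b) isOpen_Ioo (nonempty_Ioo.2 hab)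
  -- The translates of the interval by elements of `H`. They are open and cover `H`, so countably
  -- many suffice; all have the same size, and if it were below 𝔠, so would be `#H`.
  let V : H → Set H := fun h => {x | a < h⁻¹ * x ∧ (h⁻¹ * x : PosReal) < b}
  have hV : ∀ h, V h = (fun x : H => (x : PosReal)) ⁻¹' Ioo (h * a) (h * b) := fun h => by
    ext x
    simp only [V, mem_ofPred_eq, mem_preimage, mem_Ioo, InvMemClass.coe_inv, lt_inv_mul_iff_mul_lt,
      inv_mul_lt_iff_lt_mul]
  obtain ⟨T, hT, hTV⟩ := TopologicalSpace.isOpen_iUnion_countable V fun h => by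
    rw [hV]
    exact isOpen_Ioo.preimage continuous_subtype_val
  have cover : ⋃ h : T, V h = Set.univ := by
    rw [← biUnion_eq_iUnion T fun h _ => V h, hTV]
    refine eq_univ_of_forall fun x => mem_iUnion.2 ⟨x * ⟨g, hg⟩⁻¹, ?_⟩
    rw [hV]
    constructor <;> simpa [mul_assoc, inv_mul_lt_iff_lt_mul, lt_inv_mul_iff_mul_lt]
  by_contra! hlt
  set κ := #{x : H // a < x ∧ (x : PosReal) < b}
  have hVκ : ∀ h, #(V h) ≤ κ := fun h => by
    refine mk_le_of_injective (f := fun x => (⟨h⁻¹ * x.1, x.2⟩ : {x : H // a < x ∧ (x : PosReal) < b}))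
      fun x y hxy => ?_
    exact Subtype.ext (mul_left_cancel (congrArg Subtype.val hxy))
  have := hT.to_subtype
  have h₁ := mk_iUnion_le fun h : T => V h
  rw [cover, mk_univ, hH] at h₁
  refine (h₁.trans (mul_le_mul' mk_le_aleph0 (ciSup_le' fun h : T => hVκ h))).not_gt ?_
  exact mul_lt_of_lt aleph0_le_continuum aleph0_lt_continuum hlt

open Cardinal in
theorem mk_posReal : #PosReal = 𝔠 := mk_Ioi_real 0

open Cardinal in
theorem Hedgehog.isContinuumHedgehog {H : Subgroup PosReal} (hH : #H = 𝔠) :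
    IsContinuumHedgehog (Hedgehog (H : Set PosReal)) Hedgehog.coord where
  toIsHedgehog := Hedgehog.isHedgehog _
  mk_le := by
    change #(Option H) ≤ 𝔠
    rw [mk_option, hH, add_one_eq aleph0_le_continuum]
  le_mk a b ha hab := by
    -- `a` may be 0, which is not a `PosReal`.
    obtain ⟨a', haa', ha'b⟩ := exists_between hab
    have ha' := ha.trans_lt haa'
    refine (continuum_le_mk_subgroup_inter_Ioo hH
      (show (⟨a', ha'⟩ : PosReal) < ⟨b, ha'.trans ha'b⟩ from ha'b)).trans ?_
    refine mk_le_of_injective (f := fun x => ⟨some x.1, haa'.trans x.2.1, x.2.2.le⟩) ?_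
    intro x y hxy
    exact Subtype.ext (Option.some_injective _ (congrArg Subtype.val hxy))

open Cardinal in
theorem Hedgehog.isContinuumHedgehog_univ :
    IsContinuumHedgehog (Hedgehog Set.univ) Hedgehog.coord := by
  rw [← Subgroup.coe_top]
  exact Hedgehog.isContinuumHedgehog (Subgroup.topEquiv.toEquiv.cardinal_eq.trans mk_posReal)

open Cardinal in
-- An isometry sends the spine over 1, rescaled to coordinate `r`, to a spine of coordinate `r`, so
-- `r ∈ H`. Conversely, multiplication by `r ∈ H` permutes the spines.
theorem Hedgehog.st_eq {H : Subgroup PosReal} (hH : #H = 𝔠) :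
    st (Hedgehog (H : Set PosReal)) = H := by
  have hc := Hedgehog.isContinuumHedgehog hH
  ext r
  constructor
  · rintro ⟨e⟩
    have := (hc.scaled r).infinite
    have h := (hc.scaled r).coord_map hc.toIsHedgehog e.isometry ⟨some (1 : H)⟩
    have hr : (r : ℝ) * Hedgehog.coord (some (1 : H) : Hedgehog (H : Set PosReal)) = r :=
      mul_one _
    rw [hr] at h
    generalize e ⟨some (1 : H)⟩ = p at h
    obtain _ | p := p
    · exact absurd h r.2.ne
    · exact (Subtype.ext h : (p : PosReal) = r) ▸ p.2
  · intro hr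
    let m : H ≃ H := Equiv.mulLeft ⟨r, hr⟩
    let e : Scaled r (Hedgehog (H : Set PosReal)) ≃ Hedgehog (H : Set PosReal) :=
      (Equiv.mk Scaled.val Scaled.mk (fun _ => rfl) fun _ => rfl).trans (Equiv.optionCongr m)
    refine ⟨e, (hc.scaled r).isometry_of_coord_eq hc.toIsHedgehog e.injective ?_⟩
    rintro ⟨_ | p⟩
    · exact (mul_zero (r : ℝ)).symm
    · rfl

/-! ### The number of spaces in the center -/

/-- The hedgehog over all positive reals in which the spines with coordinate in `B` are doubled. -/
def DoubledHedgehog (B : Set PosReal) : Type u := ULift.{u} (Option (PosReal ⊕ B))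

namespace DoubledHedgehog

variable {B : Set PosReal}

/-- The coordinate of a point of the doubled hedgehog. -/
def coord (p : DoubledHedgehog.{u} B) : ℝ :=
  p.down.elim 0 fun x => (Sum.elim id Subtype.val x : PosReal)

theorem coord_nonneg : ∀ p : DoubledHedgehog.{u} B, 0 ≤ p.coord
  | ⟨none⟩ => le_rfl
  | ⟨some x⟩ => (Sum.elim id Subtype.val x : PosReal).2.le

theorem coord_add_pos : ∀ p q : DoubledHedgehog.{u} B, p ≠ q → 0 < p.coord + q.coord
  | ⟨none⟩, ⟨none⟩, h => (h rfl).elim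
  | ⟨some x⟩, q, _ => add_pos_of_pos_of_nonneg (Sum.elim id Subtype.val x : PosReal).2 q.coord_nonneg
  | ⟨none⟩, ⟨some x⟩, _ => add_pos_of_nonneg_of_pos le_rfl (Sum.elim id Subtype.val x : PosReal).2

open Classical in
noncomputable instance instMetricSpace (B : Set PosReal) :
    MetricSpace (DoubledHedgehog.{u} B) where
  dist p q := if p = q then 0 else p.coord + q.coord
  dist_self p := if_pos rfl
  dist_comm p q := by simp only [eq_comm (a := p), add_comm p.coord]
  dist_triangle p q r := by
    have hp := p.coord_nonneg
    have hq := q.coord_nonneg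
    have hr := r.coord_nonneg
    by_cases h₁ : p = q
    · simp [h₁]
    · by_cases h₂ : q = r
      · simp [h₂]
      · rw [if_neg h₁, if_neg h₂]
        split_ifs <;> linarith
  eq_of_dist_eq_zero {p q} h := by
    by_contra hne
    exact (coord_add_pos p q hne).ne' ((if_neg hne).symm.trans h)

open Cardinal in
theorem isContinuumHedgehog (B : Set PosReal) :
    IsContinuumHedgehog (DoubledHedgehog.{u} B) coord where
  nonneg := coord_nonneg
  dist_eq _ _ h := if_neg h
  exists_center := ⟨⟨none⟩, rfl⟩
  mk_le := by
    change #(ULift (Option (PosReal ⊕ B))) ≤ 𝔠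
    rw [mk_uLift, lift_le_continuum, mk_option, mk_sum, lift_id, lift_id, mk_posReal]
    refine (add_le_add_left (add_le_add_right ((mk_subtype_le _).trans mk_posReal.le) _) _).trans ?_
    rw [continuum_add_self, add_one_eq aleph0_le_continuum]
  le_mk a b ha hab := by
    rw [← lift_continuum.{u, 0}, ← mk_Ioc_real hab, ← mk_uLift]
    -- The undoubled copy of the positive reals already fills the interval.
    refine mk_le_of_injective
      (f := fun x => ⟨⟨some (Sum.inl ⟨x.down, ha.trans_lt x.down.2.1⟩)⟩, x.down.2⟩) fun x y hxy => ?_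
    have h₁ := Sum.inl_injective (Option.some_injective _
      (congrArg ULift.down (congrArg Subtype.val hxy)))
    exact ULift.ext _ _ (Subtype.ext (congrArg (fun z : PosReal => (z : ℝ)) h₁))

/-- The spines that are doubled can be recovered from the coordinates. -/
theorem mem_iff (b : PosReal) :
    b ∈ B ↔ ∃ p q : DoubledHedgehog.{u} B, p ≠ q ∧ p.coord = b ∧ q.coord = b := by
  constructor
  · intro hb
    refine ⟨⟨some (Sum.inl b)⟩, ⟨some (Sum.inr ⟨b, hb⟩)⟩, ?_, rfl, rfl⟩
    exact fun h => Sum.inl_ne_inr (Option.some_injective _ (congrArg ULift.down h))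
  · have hb := b.2
    rintro ⟨⟨_ | p | p⟩, ⟨_ | q | q⟩, hpq, hp, hq⟩
    · exact absurd hp hb.ne
    · exact absurd hp hb.ne
    · exact absurd hp hb.ne
    · exact absurd hq hb.ne
    · have hp' : p = b := Subtype.ext hp
      have hq' : q = b := Subtype.ext hq
      exact absurd (by rw [hp', hq']) hpq
    · have hq' : (q : PosReal) = b := Subtype.ext hq
      exact hq' ▸ q.2
    · exact absurd hq hb.ne
    · have hp' : (p : PosReal) = b := Subtype.ext hp
      exact hp' ▸ p.2
    · have hp' : (p : PosReal) = b := Subtype.ext hp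
      exact hp' ▸ p.2

theorem eq_of_isometryEquiv {B' : Set PosReal}
    (e : DoubledHedgehog.{u} B ≃ᵢ DoubledHedgehog.{u} B') : B = B' := by
  have := (isContinuumHedgehog.{u} B).infinite
  have hc := (isContinuumHedgehog.{u} B).coord_map (isContinuumHedgehog.{u} B').toIsHedgehog
    e.isometry
  ext b
  rw [mem_iff.{u}, mem_iff.{u}]
  constructor
  · rintro ⟨p, q, hpq, hp, hq⟩
    exact ⟨e p, e q, e.injective.ne hpq, (hc p).trans hp, (hc q).trans hq⟩
  · rintro ⟨p, q, hpq, hp, hq⟩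
    refine ⟨e.symm p, e.symm q, e.symm.injective.ne hpq, ?_, ?_⟩
    · rw [← hc, e.apply_symm_apply, hp]
    · rw [← hc, e.apply_symm_apply, hq]

end DoubledHedgehog

/-- The metric of a space, transported along a map to the reals. -/
def metricCode {Y : Type v} [MetricSpace Y] (i : Y → ℝ) : Set (ℝ × ℝ × ℝ) :=
  range fun p : Y × Y => (i p.1, i p.2, dist p.1 p.2)

/-- The diagonal triples recover the image of the labelling, so points with equal labels can be
matched; the third entries then agree. -/
theorem nonempty_isometryEquiv_of_metricCode_eq {Y Y' : Type v} [MetricSpace Y] [MetricSpace Y']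
    {i : Y → ℝ} {i' : Y' → ℝ} (hi : i.Injective) (hi' : i'.Injective)
    (h : metricCode i = metricCode i') : Nonempty (Y ≃ᵢ Y') := by
  have h₁ : ∀ y, ∃ y', i' y' = i y := fun y => by
    have : (i y, i y, dist y y) ∈ metricCode i' := h ▸ ⟨(y, y), rfl⟩
    obtain ⟨p, hp⟩ := this
    exact ⟨p.1, (Prod.ext_iff.1 hp).1⟩
  have h₂ : ∀ y', ∃ y, i y = i' y' := fun y' => by
    have : (i' y', i' y', dist y' y') ∈ metricCode i := h ▸ ⟨(y', y'), rfl⟩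
    obtain ⟨p, hp⟩ := this
    exact ⟨p.1, (Prod.ext_iff.1 hp).1⟩
  choose f hf using h₁
  choose g hg using h₂
  refine ⟨⟨f, g, fun y => hi (by rw [hg, hf]), fun y => hi' (by rw [hf, hg])⟩,
    Isometry.of_dist_eq fun y z => ?_⟩
  have : (i y, i z, dist y z) ∈ metricCode i' := h ▸ ⟨(y, z), rfl⟩
  obtain ⟨⟨y', z'⟩, hp⟩ := this
  simp only [Prod.mk.injEq] at hp
  obtain rfl : f y = y' := hi' (by rw [hf, hp.1])
  obtain rfl : f z = z' := hi' (by rw [hf, hp.2.1])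
  exact hp.2.2

/-! ### The two bounds for the number of isometry classes -/

namespace IsContinuumHedgehog

open Cardinal

variable {X : Type} [MetricSpace X] {c : X → ℝ}

theorem mk_center_le (h : IsContinuumHedgehog X c) : #(Center.{0, u} X) ≤ 2 ^ 𝔠 := by
  have emb : ∀ Y : CenterSpace.{0, u} X, ∃ i : Y.carrier → ℝ, i.Injective := fun Y => by
    have := h.mk_le_of_inCenter Y.mem
    rw [← lift_le_continuum.{u, 0}, ← lift_continuum.{u, 0}, ← mk_real] at this
    obtain ⟨i⟩ := lift_mk_le'.1 this
    exact ⟨i, i.injective⟩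
  choose i hi using emb
  have inj : Function.Injective fun z : Center.{0, u} X => metricCode (i z.out) := by
    intro z z' hzz'
    refine Quotient.out_equiv_out.1 ?_
    exact nonempty_isometryEquiv_of_metricCode_eq (hi _) (hi _) hzz'
  have := lift_mk_le_lift_mk_of_injective inj
  simpa [mk_real] using this

theorem le_mk_center (h : IsContinuumHedgehog X c) : 2 ^ 𝔠 ≤ #(Center.{0, u} X) := by
  have inj : Function.Injective fun B : Set PosReal =>
      (Quotient.mk _ ⟨DoubledHedgehog.{u} B, h.inCenter (DoubledHedgehog.isContinuumHedgehog B)⟩ :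
        Center.{0, u} X) := by
    intro B B' hBB'
    obtain ⟨e⟩ := Quotient.exact hBB'
    exact DoubledHedgehog.eq_of_isometryEquiv e
  have := lift_mk_le_lift_mk_of_injective inj
  rw [mk_set, mk_posReal, lift_id', lift_power, lift_continuum, lift_ofNat] at this
  exact this

end IsContinuumHedgehog

end Cloud

theorem mainTheorem6 :
    Cloud.stCloud (Cloud.Hedgehog Set.univ) ≠ {1} ∧
    (∀ H : Subgroup Cloud.PosReal, Cardinal.mk H = Cardinal.continuum →
      Cloud.InCenter (Cloud.Hedgehog Set.univ) (Cloud.Hedgehog (H : Set Cloud.PosReal)) ∧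
      Cloud.st (Cloud.Hedgehog (H : Set Cloud.PosReal)) = (H : Set Cloud.PosReal)) ∧
    Cardinal.mk (Cloud.Center.{0, u} (Cloud.Hedgehog Set.univ)) =
      2 ^ (Cardinal.continuum : Cardinal.{u + 1}) := by
  have h := Cloud.Hedgehog.isContinuumHedgehog_univ
  refine ⟨fun he => ?_, fun H hH =>
    ⟨h.inCenter (Cloud.Hedgehog.isContinuumHedgehog hH), Cloud.Hedgehog.st_eq hH⟩,
    h.mk_center_le.antisymm h.le_mk_center⟩
  rw [h.stCloud_eq_univ] at he
  have : (⟨2, two_pos⟩ : Cloud.PosReal) = 1 := he.subset (Set.mem_univ _)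
  exact absurd (congrArg Subtype.val this) (by norm_num)
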